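/- Let $N\ge 1$, let $\omega_1,\dots,\omega_N$ be distinct complex numbers with $\operatorname{Re}\omega_k>0$, and let $\alpha_{1,0},\dots,\alpha_{N,0}$ be complex numbers with $\omega_k\ne\pm\alpha_{i,0}$ for all $k,i$. Put $$C_k=\tfrac12\ln\prod_{i=1}^N\left|\frac{\omega_k-\alpha_{i,0}}{\omega_k+\alpha_{i,0}}\right| ,\qquad 1\le k\le N .$$ For $x,t\in\mathbb R$ let $\psi_k(x,t)=\exp[2(\omega_kx-\omega_k^3t-C_k)]$ (case mKdV) or $\psi_k(x,t)=\exp[2(\omega_kx+\mathrm i\,\omega_k^2t-C_k)]$ (case NSE). For $1\le j\le 2N$ let $$(z_1,\dots,z_{2N})=(\omega_1,\dots,\omega_N,-\bar\omega_1,\dots,-\bar\omega_N),\qquad (e_1,\dots,e_{2N})=(\psi_1,\dots,\psi_N,\bar\psi_1^{-1},\dots,\bar\psi_N^{-1}),$$ and define the $2N\times 2N$ paired Vandermonde determinants * $\Delta_1(x,t)$: rows $(z_j^i)_j$ for $0\le i\le N-2$, followed by rows $(z_j^i e_j)_j$ for $0\le i\le N$; * $\Delta_2(x,t)$: rows $(z_j^i)_j$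 for $0\le i\le N-1$, followed by rows $(z_j^i e_j)_j$ for $0\le i\le N-1$. Then the open set $U=\{(x,t)\in\mathbb R^2:\Delta_2(x,t)\ne0\}$ is dense in $\mathbb R^2$, and on $U$ the function $$\xi(x,t)=2(-1)^{N-1}\frac{\Delta_1(x,t)}{\Delta_2(x,t)}$$ is $C^\infty$ and satisfies, in the case mKdV, the modified Korteweg–de Vries equation $$\xi_t=-\tfrac14\,\xi_{xxx}+\tfrac32\,|\xi|^2\,\xi_x ,$$ and, in the case NSE, the non-linear Schrödinger equation $$\xi_t=\tfrac{\mathrm i}{2}\left[\xi_{xx}-2|\xi|^2\xi\right].$$ Moreover, if the families $(\omega_k)$ and $(\alpha_{k,0})$ are each invariant, up to a permutation, under complex conjugation, then in the case mKdV the same conclusions (for $U$ and for $\xi$) hold when $-\bar\omega_k$ and $\bar\psi_k^{-1}$ are replaced by $-\omega_k$ and $\psi_k^{-1}$ in the definitions of $\Delta_1$ and $\Delta_2$. -/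

import Mathlib

open scoped ComplexConjugate

noncomputable section

/-- `u` is a classical (smooth) solution on the open set `U` of the `(x, t)`-plane of the modified
Korteweg - de Vries equation `u_t = -(1/4) u_xxx + (3/2) |u|^2 u_x`. -/
structure IsMKdVSolutionOn (U : Set (ℝ × ℝ)) (u : ℝ → ℝ → ℂ) : Prop where
  isOpen : IsOpen U
  smooth : ContDiffOn ℝ ((⊤ : ℕ∞) : WithTop ℕ∞) (fun p : ℝ × ℝ => u p.1 p.2) U
  equation : ∀ x t : ℝ, (x, t) ∈ U →
    deriv (fun s : ℝ => u x s) t =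
      -(1 / 4) * iteratedDeriv 3 (fun y : ℝ => u y t) x
        + (3 / 2) * (‖u x t‖ : ℂ) ^ 2 * deriv (fun y : ℝ => u y t) x

/-- `u` is a classical (smooth) solution on the open set `U` of the `(x, t)`-plane of the non-linear
Schrödinger equation `u_t = (i/2) (u_xx - 2 |u|^2 u)`. -/
structure IsNSESolutionOn (U : Set (ℝ × ℝ)) (u : ℝ → ℝ → ℂ) : Prop where
  isOpen : IsOpen U
  smooth : ContDiffOn ℝ ((⊤ : ℕ∞) : WithTop ℕ∞) (fun p : ℝ × ℝ => u p.1 p.2) U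
  equation : ∀ x t : ℝ, (x, t) ∈ U →
    deriv (fun s : ℝ => u x s) t =
      (Complex.I / 2) * (iteratedDeriv 2 (fun y : ℝ => u y t) x
        - 2 * (‖u x t‖ : ℂ) ^ 2 * u x t)

/-- The `M × M` paired Vandermonde matrix with nodes `z` and weights `e`: the first `m` rows are
`z_j ^ i` (`0 ≤ i < m`), the other `M - m` rows are `z_j ^ i * e_j` (`0 ≤ i < M - m`). -/
def pairedVandermonde {M : ℕ} (m : ℕ) (z e : Fin M → ℂ) : Matrix (Fin M) (Fin M) ℂ :=
  fun i j => if (i : ℕ) < m then z j ^ (i : ℕ) else z j ^ ((i : ℕ) - m) * e j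

/-- The numerator: nodes `ω_1, …, ω_N, -ω'_1, …, -ω'_N`, weights `ψ_1, …, ψ_N, 1/ψ'_1, …, 1/ψ'_N`,
`N - 1` rows without weights (powers `0, …, N - 2`) above `N + 1` rows with weights
(powers `0, …, N`). -/
def Delta1 {N : ℕ} (ω ψ ω' ψ' : Fin N → ℂ) : ℂ :=
  (pairedVandermonde (N - 1) (Fin.append ω (-ω')) (Fin.append ψ ψ'⁻¹)).det

/-- The denominator: same nodes and weights as in `Delta1`, with `N` rows without weights above
`N` rows with weights (powers `0, …, N - 1` in both blocks). -/
def Delta2 {N : ℕ} (ω ψ ω' ψ' : Fin N → ℂ) : ℂ :=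
  (pairedVandermonde N (Fin.append ω (-ω')) (Fin.append ψ ψ'⁻¹)).det

/-- The ratio `2 (-1)^(N-1) Δ₁ / Δ₂` (used for `N ≥ 1` and `Δ₂ ≠ 0`). -/
def xiRatio {N : ℕ} (ω ψ ω' ψ' : Fin N → ℂ) : ℂ :=
  2 * (-1) ^ (N - 1) * (Delta1 ω ψ ω' ψ' / Delta2 ω ψ ω' ψ')

/-- `C_k = (1/2) ln ∏_i |(ω_k - α_i) / (ω_k + α_i)|`. -/
def phaseConst {N : ℕ} (ω α : Fin N → ℂ) (k : Fin N) : ℝ :=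
  (1 / 2) * Real.log (∏ i, ‖(ω k - α i) / (ω k + α i)‖)

/-- `ψ_k(x, t)` for the modified Korteweg - de Vries equation. -/
def psiMKdV {N : ℕ} (ω α : Fin N → ℂ) (x t : ℝ) (k : Fin N) : ℂ :=
  Complex.exp (2 * (ω k * x - ω k ^ 3 * t - phaseConst ω α k))

/-- `ψ_k(x, t)` for the non-linear Schrödinger equation. -/
def psiNSE {N : ℕ} (ω α : Fin N → ℂ) (x t : ℝ) (k : Fin N) : ℂ :=
  Complex.exp (2 * (ω k * x + Complex.I * ω k ^ 2 * t - phaseConst ω α k))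

/-- The family (with multiplicities) is symmetric with respect to the real axis. -/
def IsConjSymm {N : ℕ} (a : Fin N → ℂ) : Prop :=
  ∃ σ : Equiv.Perm (Fin N), ∀ k, a (σ k) = conj (a k)

end

/-!
With `A = ∑ α_k w^k` and `B = ∑ β_k w^k` polynomials of degree at most `N` in `w = 1 / z`, the
`2 N` conditions `A (1 / z_j) + e_j B (1 / z_j) = 0` are a linear system with determinant `Δ₂` as
soon as the constant terms are prescribed. Where `Δ₂ ≠ 0` there is one such pair `(A, B)` with
constant terms `(0, 1)` and one pair `(C, D)` with constant terms `(1, 0)`, and Cramer's rule gives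
`ξ = 2 α₁` (`xiRatio_eq_padeFst`).

The weights satisfy `∂ₓ e_j = 2 z_j e_j`, and `∂ₜ e_j = -2 z_j³ e_j` or `∂ₜ e_j = 2 i z_j² e_j`.
Differentiating the conditions for `(A, B)` and subtracting a suitable combination of `(A, B)` and
`(C, D)` with coefficients polynomial in `w` leaves a pair that still satisfies all conditions but
has too few coefficients not to vanish (`eq_zero_of_forall_eval_eq_zero`). In `x` this yields
`A_x = 2 z A - 2 a C`, `B_x = -2 a D`, `C_x = 2 d A`, `D_x = -2 z D + 2 d B`, where `a = α₁` and
`d = δ₁` (`hasDerivAt_pade`); in `t` it yields the matching time evolution (`hasDerivAt_pade_nse`,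
`hasDerivAt_pade_mkdv`). Eliminating all other coefficients leaves `a_t = (i / 2) (a_xx + 8 a² d)`
and `a_t = - a_xxx / 4 - 6 a d a_x`. The nodes and weights are invariant under `z ↦ -z̄`,
`e ↦ 1 / ē`, which maps `(A, B)` to `(C, D)`; hence `d = -ā` (`padeSnd_one_eq_neg_conj`), and the
two equations become those for `ξ`.

Density of `Δ₂ ≠ 0`: for fixed `t`, `Δ₂` is real analytic in `x`, and after division of the growing
columns by their weights it tends, as `x → ∞`, to a block determinant made of two Vandermonde
determinants with distinct nodes. For conjugation-symmetric data, dropping the conjugations permutes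
the last `N` columns of both determinants in the same way.
-/

open scoped ComplexConjugate

open Polynomial Matrix

/-! ### Uniqueness of the interpolation pair -/

theorem pairedVandermonde_vecMul {N : ℕ} (z e v : Fin (N + N) → ℂ) (j : Fin (N + N)) :
    (v ᵥ* pairedVandermonde N z e) j =
      ∑ i : Fin N, v (Fin.castAdd N i) * z j ^ (i : ℕ) +
        e j * ∑ i : Fin N, v (Fin.natAdd N i) * z j ^ (i : ℕ) := by
  simp only [vecMul, dotProduct, Fin.sum_univ_add, pairedVandermonde, Finset.mul_sum]
  congr 1
  · simp
  · refine Finset.sum_congr rfl fun i _ => ?_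
    simp
    ring

theorem eq_zero_of_forall_sum_eq_zero {N : ℕ} {z e : Fin (N + N) → ℂ}
    (hdet : (pairedVandermonde N z e).det ≠ 0) {p q : Fin N → ℂ}
    (h : ∀ j, ∑ i, p i * z j ^ (i : ℕ) + e j * ∑ i, q i * z j ^ (i : ℕ) = 0) :
    p = 0 ∧ q = 0 := by
  have hv : Fin.append p q = 0 := by
    refine Matrix.eq_zero_of_vecMul_eq_zero hdet (funext fun j => ?_)
    rw [pairedVandermonde_vecMul]
    simpa only [Fin.append_left, Fin.append_right, Pi.zero_apply] using h j
  constructor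
  · funext i
    simpa only [Fin.append_left, Pi.zero_apply] using congrFun hv (Fin.castAdd N i)
  · funext i
    simpa only [Fin.append_right, Pi.zero_apply] using congrFun hv (Fin.natAdd N i)

theorem eval_inv_mul_pow {N s : ℕ} {p : ℂ[X]} (hlow : ∀ k ≤ s, p.coeff k = 0)
    (hhigh : ∀ k, N + s < k → p.coeff k = 0) {z : ℂ} (hz : z ≠ 0) :
    p.eval z⁻¹ * z ^ (N + s) = ∑ i : Fin N, p.coeff (N + s - i) * z ^ (i : ℕ) := by
  have hdeg : p.natDegree < (s + 1) + N := by
    have : p.natDegree ≤ N + s := natDegree_le_iff_coeff_eq_zero.2 hhigh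
    omega
  rw [eval_eq_sum_range' hdeg, Finset.sum_range_add, Finset.sum_eq_zero, zero_add,
    ← Finset.sum_range_reflect, Finset.sum_mul,
    Fin.sum_univ_eq_sum_range (fun i => p.coeff (N + s - i) * z ^ i)]
  · refine Finset.sum_congr rfl fun i hi => ?_
    have hi' := Finset.mem_range.1 hi
    have h1 : s + 1 + (N - 1 - i) = N + s - i := by omega
    have h2 : z ^ (N + s) = z ^ (N + s - i) * z ^ i := by rw [← pow_add]; congr 1; omega
    rw [h1, h2, inv_pow]
    have := pow_ne_zero (N + s - i) hz
    field_simp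
  · intro k hk
    rw [hlow k (by have := Finset.mem_range.1 hk; omega), zero_mul]

/-- Uniqueness: if `Δ₂ ≠ 0`, a pair of polynomials, each with only the `N` coefficients of index
`s + 1, …, s + N`, that satisfies `p (1 / z_j) + e_j q (1 / z_j) = 0` at all `2 N` nodes is zero. -/
theorem eq_zero_of_forall_eval_eq_zero {N : ℕ} {z e : Fin (N + N) → ℂ}
    (hdet : (pairedVandermonde N z e).det ≠ 0) (hz : ∀ j, z j ≠ 0) (s : ℕ) {p q : ℂ[X]}
    (hp : ∀ k ≤ s, p.coeff k = 0) (hp' : ∀ k, N + s < k → p.coeff k = 0)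
    (hq : ∀ k ≤ s, q.coeff k = 0) (hq' : ∀ k, N + s < k → q.coeff k = 0)
    (h : ∀ j, p.eval (z j)⁻¹ + e j * q.eval (z j)⁻¹ = 0) : p = 0 ∧ q = 0 := by
  obtain ⟨h1, h2⟩ := eq_zero_of_forall_sum_eq_zero hdet
    (p := fun i => p.coeff (N + s - i)) (q := fun i => q.coeff (N + s - i)) (fun j => by
      rw [← eval_inv_mul_pow hp hp' (hz j), ← eval_inv_mul_pow hq hq' (hz j), ← mul_assoc,
        ← add_mul, h j, zero_mul])
  have key : ∀ r : ℂ[X], (∀ k ≤ s, r.coeff k = 0) → (∀ k, N + s < k → r.coeff k = 0) →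
      (fun i : Fin N => r.coeff (N + s - i)) = 0 → r = 0 := by
    intro r hr hr' h0
    ext k
    rcases le_or_gt k s with hk | hk
    · simpa using hr k hk
    · rcases lt_or_ge (N + s) k with hk' | hk'
      · simpa using hr' k hk'
      · have := congrFun h0 ⟨N + s - k, by omega⟩
        have e1 : N + s - (N + s - k) = k := by omega
        simpa [e1] using this
  exact ⟨key p hp hp' h1, key q hq hq' h2⟩

/-! ### Interpolation pairs -/

/-- The sequence with constant term `c`, whose next `N` terms are those of `u` in reverse order,
continued by zero. -/
noncomputable def revSeq {N : ℕ} (c : ℂ) (u : Fin N → ℂ) (k : ℕ) : ℂ :=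
  if k = 0 then c else if h : k - 1 < N then u (Fin.rev ⟨k - 1, h⟩) else 0

@[simp] theorem revSeq_zero {N : ℕ} (c : ℂ) (u : Fin N → ℂ) : revSeq c u 0 = c := by
  simp [revSeq]

theorem revSeq_of_lt {N : ℕ} (c : ℂ) (u : Fin N → ℂ) {k : ℕ} (hk : N < k) : revSeq c u k = 0 := by
  rw [revSeq, if_neg (by omega), dif_neg (by omega)]

theorem sum_revSeq_inv_mul_pow {N : ℕ} (c : ℂ) (u : Fin N → ℂ) {z : ℂ} (hz : z ≠ 0) :
    (∑ k ∈ Finset.range (N + 1), revSeq c u k * z⁻¹ ^ k) * z ^ N =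
      c * z ^ N + ∑ i : Fin N, u i * z ^ (i : ℕ) := by
  rw [Finset.sum_range_succ', add_mul, add_comm]
  congr 1
  · simp
  · rw [← Fin.sum_univ_eq_sum_range (fun k => revSeq c u (k + 1) * z⁻¹ ^ (k + 1)),
      ← Equiv.sum_comp Fin.revPerm, Finset.sum_mul]
    refine Finset.sum_congr rfl fun i _ => ?_
    have h1 : ((Fin.revPerm i : Fin N) : ℕ) + 1 = N - i := by
      simp [Fin.val_rev]; omega
    have h2 : revSeq c u ((Fin.revPerm i : Fin N) + 1) = u i := by
      have h4 : ((Fin.revPerm i : Fin N) : ℕ) + 1 - 1 < N := by have := (Fin.revPerm i).2; omega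
      rw [revSeq, if_neg (by omega), dif_pos h4]
      congr 1
      exact Fin.rev_rev i
    have h3 : z ^ N = z ^ (N - (i : ℕ)) * z ^ (i : ℕ) := by rw [← pow_add]; congr 1; omega
    rw [h2, h1, h3, inv_pow]
    have := pow_ne_zero (N - (i : ℕ)) hz
    field_simp

/-- Cramer's solution `v` of `∑_{i<N} v_i z_j^i + e_j ∑_{i<N} v_{N+i} z_j^i = - z_j^N (c + d e_j)`
for all `j` (zero when `Δ₂ = 0`). -/
noncomputable def padeVec {N : ℕ} (z e : Fin (N + N) → ℂ) (c d : ℂ) : Fin (N + N) → ℂ := fun i =>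
  -(((pairedVandermonde N z e).updateRow i fun j => z j ^ N * (c + d * e j)).det /
    (pairedVandermonde N z e).det)

theorem padeVec_spec {N : ℕ} {z e : Fin (N + N) → ℂ}
    (hdet : (pairedVandermonde N z e).det ≠ 0) (c d : ℂ) (j : Fin (N + N)) :
    ∑ i : Fin N, padeVec z e c d (Fin.castAdd N i) * z j ^ (i : ℕ) +
      e j * ∑ i : Fin N, padeVec z e c d (Fin.natAdd N i) * z j ^ (i : ℕ) =
        -(z j ^ N * (c + d * e j)) := by
  set M := pairedVandermonde N z e with hM
  set r : Fin (N + N) → ℂ := fun j => z j ^ N * (c + d * e j) with hr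
  have h1 : padeVec z e c d = -(M.det)⁻¹ • cramer Mᵀ r := by
    funext i
    simp only [padeVec, Pi.smul_apply, cramer_transpose_apply, smul_eq_mul]
    rw [← hM, ← hr]
    ring
  rw [← pairedVandermonde_vecMul, ← mulVec_transpose, h1, mulVec_smul, mulVec_cramer,
    det_transpose]
  simp only [Pi.smul_apply, smul_eq_mul, hr]
  rw [← mul_assoc, neg_mul, inv_mul_cancel₀ hdet, neg_one_mul]

/-- Coefficient of index `k` of the first component of the polynomial pair `(P, Q)` of degree `≤ N`
with constant terms `c` and `d` and `P (1 / z_j) + e_j Q (1 / z_j) = 0` for all `j`. -/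
noncomputable def padeFst {N : ℕ} (z e : Fin (N + N) → ℂ) (c d : ℂ) : ℕ → ℂ :=
  revSeq c fun i => padeVec z e c d (Fin.castAdd N i)

/-- Coefficient of index `k` of the second component of the pair described at `padeFst`. -/
noncomputable def padeSnd {N : ℕ} (z e : Fin (N + N) → ℂ) (c d : ℂ) : ℕ → ℂ :=
  revSeq d fun i => padeVec z e c d (Fin.natAdd N i)

/-- The polynomial of degree `≤ N` with coefficients `a_0, …, a_N`. -/
noncomputable def seqPoly (N : ℕ) (a : ℕ → ℂ) : ℂ[X] := ∑ k ∈ Finset.range (N + 1), C (a k) * X ^ k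

theorem eval_seqPoly (N : ℕ) (a : ℕ → ℂ) (w : ℂ) :
    (seqPoly N a).eval w = ∑ k ∈ Finset.range (N + 1), a k * w ^ k := by
  simp [seqPoly, eval_finsetSum]

theorem coeff_seqPoly {N : ℕ} {a : ℕ → ℂ} (ha : ∀ k, N < k → a k = 0) (k : ℕ) :
    (seqPoly N a).coeff k = a k := by
  simp only [seqPoly, finsetSum_coeff, coeff_C_mul, coeff_X_pow, mul_ite, mul_one, mul_zero,
    Finset.sum_ite_eq, Finset.mem_range]
  split_ifs with h
  · rfl
  · exact (ha k (by omega)).symm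

theorem eval_pade_eq_zero {N : ℕ} {z e : Fin (N + N) → ℂ}
    (hdet : (pairedVandermonde N z e).det ≠ 0) (hz : ∀ j, z j ≠ 0) (c d : ℂ) (j : Fin (N + N)) :
    (seqPoly N (padeFst z e c d)).eval (z j)⁻¹ +
      e j * (seqPoly N (padeSnd z e c d)).eval (z j)⁻¹ = 0 := by
  have h := padeVec_spec hdet c d j
  rw [eval_seqPoly, eval_seqPoly]
  refine (mul_eq_zero.1 ?_).resolve_right (pow_ne_zero N (hz j))
  rw [add_mul, mul_assoc, padeFst, padeSnd, sum_revSeq_inv_mul_pow _ _ (hz j),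
    sum_revSeq_inv_mul_pow _ _ (hz j)]
  linear_combination h

@[simp] theorem padeFst_zero {N : ℕ} (z e : Fin (N + N) → ℂ) (c d : ℂ) :
    padeFst z e c d 0 = c := revSeq_zero _ _

@[simp] theorem padeSnd_zero {N : ℕ} (z e : Fin (N + N) → ℂ) (c d : ℂ) :
    padeSnd z e c d 0 = d := revSeq_zero _ _

theorem padeFst_of_lt {N : ℕ} (z e : Fin (N + N) → ℂ) (c d : ℂ) {k : ℕ} (hk : N < k) :
    padeFst z e c d k = 0 := revSeq_of_lt _ _ hk

theorem padeSnd_of_lt {N : ℕ} (z e : Fin (N + N) → ℂ) (c d : ℂ) {k : ℕ} (hk : N < k) :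
    padeSnd z e c d k = 0 := revSeq_of_lt _ _ hk

theorem coeff_padeFst {N : ℕ} (z e : Fin (N + N) → ℂ) (c d : ℂ) (k : ℕ) :
    (seqPoly N (padeFst z e c d)).coeff k = padeFst z e c d k :=
  coeff_seqPoly (fun _ => padeFst_of_lt z e c d) k

theorem coeff_padeSnd {N : ℕ} (z e : Fin (N + N) → ℂ) (c d : ℂ) (k : ℕ) :
    (seqPoly N (padeSnd z e c d)).coeff k = padeSnd z e c d k :=
  coeff_seqPoly (fun _ => padeSnd_of_lt z e c d) k

/-! ### The reduction -/

/-- If the data are invariant under `z ↦ -z̄`, `e ↦ 1 / ē`, then `(A, B) ↦ (B*, A*)` with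
`P*(w) = conj (P (-w̄))` carries the pair with constant terms `(0, 1)` to the one with constant terms
`(1, 0)`. -/
theorem padeSnd_one_eq_neg_conj {N : ℕ} {z e : Fin (N + N) → ℂ}
    (hdet : (pairedVandermonde N z e).det ≠ 0) (hz : ∀ j, z j ≠ 0) (he : ∀ j, e j ≠ 0)
    (hsym : ∀ j, ∃ i, z j = -conj (z i) ∧ e j = (conj (e i))⁻¹) :
    padeSnd z e 1 0 1 = -conj (padeFst z e 0 1 1) := by
  set A := seqPoly N (padeFst z e 0 1) with hA
  set B := seqPoly N (padeSnd z e 0 1) with hB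
  have hconj : ∀ (a : ℕ → ℂ) (x : ℂ),
      (seqPoly N fun k => (-1) ^ k * conj (a k)).eval (-conj x) =
        conj ((seqPoly N a).eval x) := by
    intro a x
    rw [eval_seqPoly, eval_seqPoly, map_sum]
    refine Finset.sum_congr rfl fun k _ => ?_
    rw [neg_pow, map_mul, map_pow]
    have : ((-1 : ℂ) ^ k) * (-1) ^ k = 1 := by rw [← mul_pow]; simp
    linear_combination (conj (a k) * conj x ^ k) * this
  have hlt1 : ∀ k, N < k → (-1) ^ k * conj (padeFst z e 0 1 k) = 0 := fun k hk => by
    simp [padeFst_of_lt z e 0 1 hk]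
  have hlt2 : ∀ k, N < k → (-1) ^ k * conj (padeSnd z e 0 1 k) = 0 := fun k hk => by
    simp [padeSnd_of_lt z e 0 1 hk]
  obtain ⟨-, h2⟩ := eq_zero_of_forall_eval_eq_zero hdet hz 0
    (p := (seqPoly N fun k => (-1) ^ k * conj (padeSnd z e 0 1 k)) - seqPoly N (padeFst z e 1 0))
    (q := (seqPoly N fun k => (-1) ^ k * conj (padeFst z e 0 1 k)) - seqPoly N (padeSnd z e 1 0))
    (fun k hk => by
      obtain rfl : k = 0 := by omega
      rw [coeff_sub, coeff_padeFst, coeff_seqPoly hlt2]; simp)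
    (fun k hk => by
      rw [coeff_sub, coeff_padeFst, coeff_seqPoly hlt2, hlt2 k hk, padeFst_of_lt _ _ _ _ hk]
      simp)
    (fun k hk => by
      obtain rfl : k = 0 := by omega
      rw [coeff_sub, coeff_padeSnd, coeff_seqPoly hlt1]; simp)
    (fun k hk => by
      rw [coeff_sub, coeff_padeSnd, coeff_seqPoly hlt1, hlt1 k hk, padeSnd_of_lt _ _ _ _ hk]
      simp)
    (fun j => by
      obtain ⟨i, hi1, hi2⟩ := hsym j
      have h0 := eval_pade_eq_zero hdet hz 1 0 j
      have h1 := congrArg conj (eval_pade_eq_zero hdet hz 0 1 i)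
      rw [map_add, map_mul, map_zero] at h1
      have hw : (z j)⁻¹ = -conj (z i)⁻¹ := by rw [hi1, map_inv₀, inv_neg]
      have hi3 : conj (e i) ≠ 0 := by simpa using he i
      have hi4 : e j * conj (e i) = 1 := by rw [hi2, inv_mul_cancel₀ hi3]
      rw [eval_sub, eval_sub]
      have e1 := hconj (padeFst z e 0 1) (z i)⁻¹
      have e2 := hconj (padeSnd z e 0 1) (z i)⁻¹
      rw [← hw] at e1 e2
      rw [e1, e2]
      linear_combination -h0 + e j * h1 - conj (B.eval (z i)⁻¹) * hi4)
  have := congrArg (fun p => p.coeff 1) h2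
  simp only [coeff_sub, coeff_padeSnd, coeff_seqPoly hlt1, coeff_zero] at this
  linear_combination -this

/-! ### Differentiability of determinants and of the coefficients -/

theorem DifferentiableAt.matrix_det {n : ℕ} {M : ℝ → Matrix (Fin n) (Fin n) ℂ} {s : ℝ}
    (h : ∀ i j, DifferentiableAt ℝ (fun s => M s i j) s) :
    DifferentiableAt ℝ (fun s => (M s).det) s := by
  simp only [det_apply']
  exact DifferentiableAt.fun_sum fun σ _ =>
    (DifferentiableAt.fun_finsetProd fun i _ => h _ _).const_mul _

theorem ContDiff.matrix_det {n : ℕ} {E : Type*} [NormedAddCommGroup E] [NormedSpace ℝ E]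
    {k : WithTop ℕ∞} {M : E → Matrix (Fin n) (Fin n) ℂ} (h : ∀ i j, ContDiff ℝ k (fun s => M s i j)) :
    ContDiff ℝ k (fun s => (M s).det) := by
  simp only [det_apply']
  exact ContDiff.sum fun σ _ => contDiff_const.mul (contDiff_prod fun i _ => h _ _)

theorem differentiableAt_pairedVandermonde {n m : ℕ} {z : Fin n → ℂ} {e : ℝ → Fin n → ℂ}
    {s : ℝ} (he : ∀ j, DifferentiableAt ℝ (fun s => e s j) s) (i j : Fin n) :
    DifferentiableAt ℝ (fun s => pairedVandermonde m z (e s) i j) s := by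
  unfold pairedVandermonde
  split_ifs
  · exact differentiableAt_const _
  · exact (he j).const_mul _

theorem differentiableAt_padeVec {N : ℕ} {z : Fin (N + N) → ℂ} {e : ℝ → Fin (N + N) → ℂ}
    {s : ℝ} (he : ∀ j, DifferentiableAt ℝ (fun s => e s j) s)
    (hdet : (pairedVandermonde N z (e s)).det ≠ 0) (c d : ℂ) (i : Fin (N + N)) :
    DifferentiableAt ℝ (fun s => padeVec z (e s) c d i) s := by
  have h1 := DifferentiableAt.matrix_det (differentiableAt_pairedVandermonde (m := N) (z := z) he)
  refine (DifferentiableAt.fun_div (DifferentiableAt.matrix_det fun i' j => ?_) h1 hdet).fun_neg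
  simp only [updateRow_apply]
  split_ifs
  · exact ((he j).const_mul d).const_add c |>.const_mul _
  · exact differentiableAt_pairedVandermonde he _ _

theorem differentiableAt_revSeq {N : ℕ} {c : ℂ} {u : ℝ → Fin N → ℂ} {s : ℝ}
    (hu : ∀ i, DifferentiableAt ℝ (fun s => u s i) s) (k : ℕ) :
    DifferentiableAt ℝ (fun s => revSeq c (u s) k) s := by
  unfold revSeq
  split_ifs
  · exact differentiableAt_const _
  · exact hu _
  · exact differentiableAt_const _

/-! ### The flows on the interpolation pairs -/

/-- The interpolation conditions, differentiated along a parameter on which every weight depends by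
`e_j' = m_j e_j`. -/
theorem exists_deriv_pade {N : ℕ} {z m : Fin (N + N) → ℂ} {e : ℝ → Fin (N + N) → ℂ} {s : ℝ}
    (hz : ∀ j, z j ≠ 0) (he : ∀ j, HasDerivAt (fun s => e s j) (m j * e s j) s)
    (hdet : (pairedVandermonde N z (e s)).det ≠ 0) (c d : ℂ) :
    ∃ P Q : ℂ[X],
      (∀ k, HasDerivAt (fun s => padeFst z (e s) c d k) (P.coeff k) s) ∧
      (∀ k, HasDerivAt (fun s => padeSnd z (e s) c d k) (Q.coeff k) s) ∧
      (P.coeff 0 = 0 ∧ ∀ k, N < k → P.coeff k = 0) ∧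
      (Q.coeff 0 = 0 ∧ ∀ k, N < k → Q.coeff k = 0) ∧
      ∀ j, P.eval (z j)⁻¹ + e s j * (Q.eval (z j)⁻¹ +
        m j * (seqPoly N (padeSnd z (e s) c d)).eval (z j)⁻¹) = 0 := by
  have hd : ∀ j, DifferentiableAt ℝ (fun s => e s j) s := fun j => (he j).differentiableAt
  have h1 : ∀ k, HasDerivAt (fun s => padeFst z (e s) c d k)
      (deriv (fun s => padeFst z (e s) c d k) s) s := fun k =>
    (differentiableAt_revSeq (fun i => differentiableAt_padeVec hd hdet c d _) k).hasDerivAt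
  have h2 : ∀ k, HasDerivAt (fun s => padeSnd z (e s) c d k)
      (deriv (fun s => padeSnd z (e s) c d k) s) s := fun k =>
    (differentiableAt_revSeq (fun i => differentiableAt_padeVec hd hdet c d _) k).hasDerivAt
  have h1' : ∀ k, N < k → deriv (fun s => padeFst z (e s) c d k) s = 0 := fun k hk => by
    simp [padeFst_of_lt _ _ c d hk]
  have h2' : ∀ k, N < k → deriv (fun s => padeSnd z (e s) c d k) s = 0 := fun k hk => by
    simp [padeSnd_of_lt _ _ c d hk]
  refine ⟨seqPoly N fun k => deriv (fun s => padeFst z (e s) c d k) s,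
    seqPoly N fun k => deriv (fun s => padeSnd z (e s) c d k) s, fun k => ?_, fun k => ?_,
    ⟨?_, fun k hk => ?_⟩, ⟨?_, fun k hk => ?_⟩, fun j => ?_⟩
  · rw [coeff_seqPoly h1']; exact h1 k
  · rw [coeff_seqPoly h2']; exact h2 k
  · rw [coeff_seqPoly h1']; simp
  · rw [coeff_seqPoly h1', h1' k hk]
  · rw [coeff_seqPoly h2']; simp
  · rw [coeff_seqPoly h2', h2' k hk]
  · have hF : HasDerivAt (fun s => (seqPoly N (padeFst z (e s) c d)).eval (z j)⁻¹)
        ((seqPoly N fun k => deriv (fun s => padeFst z (e s) c d k) s).eval (z j)⁻¹) s := by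
      simp only [eval_seqPoly]
      exact HasDerivAt.fun_sum fun k _ => (h1 k).mul_const _
    have hS : HasDerivAt (fun s => (seqPoly N (padeSnd z (e s) c d)).eval (z j)⁻¹)
        ((seqPoly N fun k => deriv (fun s => padeSnd z (e s) c d k) s).eval (z j)⁻¹) s := by
      simp only [eval_seqPoly]
      exact HasDerivAt.fun_sum fun k _ => (h2 k).mul_const _
    have hcont : ContinuousAt (fun s => (pairedVandermonde N z (e s)).det) s :=
      (DifferentiableAt.matrix_det (differentiableAt_pairedVandermonde hd)).continuousAt
    have hzero : (fun s => (seqPoly N (padeFst z (e s) c d)).eval (z j)⁻¹ +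
        e s j * (seqPoly N (padeSnd z (e s) c d)).eval (z j)⁻¹) =ᶠ[nhds s] fun _ => 0 := by
      filter_upwards [hcont.eventually_ne hdet] with s' hs'
      exact eval_pade_eq_zero hs' hz c d j
    have := (hF.fun_add ((he j).fun_mul hS)).unique
      ((hasDerivAt_const s (0 : ℂ)).congr_of_eventuallyEq hzero)
    linear_combination this

/-- The `x`-flow: the coefficients of index `k` in `A_x = 2 z A - 2 a C`, `B_x = -2 a D`,
`C_x = 2 d A`, `D_x = -2 z D + 2 d B`, which is the AKNS spectral problem. -/
theorem hasDerivAt_pade {N : ℕ} {z : Fin (N + N) → ℂ} {e : ℝ → Fin (N + N) → ℂ} {s : ℝ}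
    (hz : ∀ j, z j ≠ 0) (he : ∀ j, HasDerivAt (fun s => e s j) (2 * z j * e s j) s)
    (hdet : (pairedVandermonde N z (e s)).det ≠ 0) (k : ℕ) :
    HasDerivAt (fun s => padeFst z (e s) 0 1 k)
      (2 * padeFst z (e s) 0 1 (k + 1) - 2 * padeFst z (e s) 0 1 1 * padeFst z (e s) 1 0 k) s ∧
    HasDerivAt (fun s => padeSnd z (e s) 0 1 k)
      (-2 * padeFst z (e s) 0 1 1 * padeSnd z (e s) 1 0 k) s ∧
    HasDerivAt (fun s => padeFst z (e s) 1 0 k)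
      (2 * padeSnd z (e s) 1 0 1 * padeFst z (e s) 0 1 k) s ∧
    HasDerivAt (fun s => padeSnd z (e s) 1 0 k)
      (-2 * padeSnd z (e s) 1 0 (k + 1) + 2 * padeSnd z (e s) 1 0 1 * padeSnd z (e s) 0 1 k) s := by
  obtain ⟨P, Q, hP, hQ, ⟨hP0, hPN⟩, ⟨hQ0, hQN⟩, hE⟩ := exists_deriv_pade hz he hdet 0 1
  obtain ⟨R, S, hR, hS, ⟨hR0, hRN⟩, ⟨hS0, hSN⟩, hE'⟩ := exists_deriv_pade hz he hdet 1 0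
  have cA := coeff_padeFst z (e s) 0 1
  have cB := coeff_padeSnd z (e s) 0 1
  have cC := coeff_padeFst z (e s) 1 0
  have cD := coeff_padeSnd z (e s) 1 0
  have hAB := eval_pade_eq_zero hdet hz 0 1
  have hCD := eval_pade_eq_zero hdet hz 1 0
  have zA := fun k hk => padeFst_of_lt z (e s) 0 1 (k := k) hk
  have zB := fun k hk => padeSnd_of_lt z (e s) 0 1 (k := k) hk
  have zC := fun k hk => padeFst_of_lt z (e s) 1 0 (k := k) hk
  have zD := fun k hk => padeSnd_of_lt z (e s) 1 0 (k := k) hk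
  set a := padeFst z (e s) 0 1 1 with ha
  set d := padeSnd z (e s) 1 0 1 with hd
  set A := seqPoly N (padeFst z (e s) 0 1)
  set B := seqPoly N (padeSnd z (e s) 0 1)
  set C' := seqPoly N (padeFst z (e s) 1 0)
  set D := seqPoly N (padeSnd z (e s) 1 0)
  have hw : ∀ j, (z j)⁻¹ * z j = 1 := fun j => inv_mul_cancel₀ (hz j)
  obtain ⟨h1, h2⟩ := eq_zero_of_forall_eval_eq_zero hdet hz 1
    (p := X * (P + C (2 * a) * C') - C 2 * A) (q := X * (Q + C (2 * a) * D))
    (fun k hk => by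
      interval_cases k
      · simp [cA]
      · simp [coeff_X_mul, cA, cC, hP0, ha, -map_mul])
    (fun k hk => by
      obtain ⟨k, rfl⟩ : ∃ l, k = l + 1 := ⟨k - 1, by omega⟩
      simp [coeff_X_mul, cA, cC, hPN k (by omega), zC k (by omega), zA (k + 1) (by omega),
        -map_mul])
    (fun k hk => by
      interval_cases k
      · simp
      · simp [coeff_X_mul, cD, hQ0, -map_mul])
    (fun k hk => by
      obtain ⟨k, rfl⟩ : ∃ l, k = l + 1 := ⟨k - 1, by omega⟩
      simp [coeff_X_mul, cD, hQN k (by omega), zD k (by omega), -map_mul])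
    (fun j => by
      simp only [eval_sub, eval_mul, eval_add, eval_X, eval_C]
      linear_combination (z j)⁻¹ * hE j - 2 * hAB j + 2 * a * (z j)⁻¹ * hCD j
        - 2 * e s j * B.eval (z j)⁻¹ * hw j)
  obtain ⟨h3, h4⟩ := eq_zero_of_forall_eval_eq_zero hdet hz 1
    (p := X * (R - C (2 * d) * A)) (q := X * (S - C (2 * d) * B) + C 2 * D)
    (fun k hk => by
      interval_cases k
      · simp
      · simp [coeff_X_mul, cA, hR0, -map_mul])
    (fun k hk => by
      obtain ⟨k, rfl⟩ : ∃ l, k = l + 1 := ⟨k - 1, by omega⟩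
      simp [coeff_X_mul, cA, hRN k (by omega), zA k (by omega), -map_mul])
    (fun k hk => by
      interval_cases k
      · simp [cD]
      · simp [coeff_X_mul, cD, cB, hS0, hd, -map_mul])
    (fun k hk => by
      obtain ⟨k, rfl⟩ : ∃ l, k = l + 1 := ⟨k - 1, by omega⟩
      simp [coeff_X_mul, cD, cB, hSN k (by omega), zB k (by omega), zD (k + 1) (by omega),
        -map_mul])
    (fun j => by
      simp only [eval_sub, eval_mul, eval_add, eval_X, eval_C]
      linear_combination (z j)⁻¹ * hE' j - 2 * d * (z j)⁻¹ * hAB j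
        - 2 * e s j * D.eval (z j)⁻¹ * hw j)
  have g1 := congrArg (fun p => p.coeff (k + 1)) h1
  have g2 := congrArg (fun p => p.coeff (k + 1)) h2
  have g3 := congrArg (fun p => p.coeff (k + 1)) h3
  have g4 := congrArg (fun p => p.coeff (k + 1)) h4
  simp only [coeff_sub, coeff_add, coeff_X_mul, coeff_C_mul, coeff_zero, cA, cB, cC, cD]
    at g1 g2 g3 g4
  refine ⟨(hP k).congr_deriv ?_, (hQ k).congr_deriv ?_, (hR k).congr_deriv ?_,
    (hS k).congr_deriv ?_⟩
  · linear_combination g1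
  · linear_combination g2
  · linear_combination g3
  · linear_combination g4

/-- The quadratic flow `e_j' = 2 i z_j² e_j`, read off at the first coefficient. The scalars `κ`, `μ`,
`ν` are chosen so that the coefficients of index `≤ 2` cancel in the pair
`2 i (A, 0) + (κ w + μ w²) (C, D) + w² (ν (A, B) - (A, B)_t)`. It then vanishes by uniqueness, and
its coefficient of index `3` is the claim. -/
theorem hasDerivAt_pade_nse {N : ℕ} {z : Fin (N + N) → ℂ} {e : ℝ → Fin (N + N) → ℂ} {s : ℝ}
    (hz : ∀ j, z j ≠ 0)
    (he : ∀ j, HasDerivAt (fun s => e s j) (2 * Complex.I * z j ^ 2 * e s j) s)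
    (hdet : (pairedVandermonde N z (e s)).det ≠ 0) {a α₂ α₃ γ₁ γ₂ d κ μ ν : ℂ}
    (ha : a = padeFst z (e s) 0 1 1) (hα₂ : α₂ = padeFst z (e s) 0 1 2)
    (hα₃ : α₃ = padeFst z (e s) 0 1 3) (hγ₁ : γ₁ = padeFst z (e s) 1 0 1)
    (hγ₂ : γ₂ = padeFst z (e s) 1 0 2) (hd : d = padeSnd z (e s) 1 0 1)
    (hκ : κ = -2 * Complex.I * a) (hμ : μ = -2 * Complex.I * α₂ - κ * γ₁) (hν : ν = -κ * d) :
    HasDerivAt (fun s => padeFst z (e s) 0 1 1)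
      (2 * Complex.I * α₃ + κ * γ₂ + μ * γ₁ + ν * a) s := by
  obtain ⟨P, Q, hP, hQ, ⟨hP0, hPN⟩, ⟨hQ0, hQN⟩, hE⟩ := exists_deriv_pade hz he hdet 0 1
  have cA := coeff_padeFst z (e s) 0 1
  have cB := coeff_padeSnd z (e s) 0 1
  have cC := coeff_padeFst z (e s) 1 0
  have cD := coeff_padeSnd z (e s) 1 0
  have hAB := eval_pade_eq_zero hdet hz 0 1
  have hCD := eval_pade_eq_zero hdet hz 1 0
  have zA := fun k hk => padeFst_of_lt z (e s) 0 1 (k := k) hk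
  have zB := fun k hk => padeSnd_of_lt z (e s) 0 1 (k := k) hk
  have zC := fun k hk => padeFst_of_lt z (e s) 1 0 (k := k) hk
  have zD := fun k hk => padeSnd_of_lt z (e s) 1 0 (k := k) hk
  set A := seqPoly N (padeFst z (e s) 0 1)
  set B := seqPoly N (padeSnd z (e s) 0 1)
  set C' := seqPoly N (padeFst z (e s) 1 0)
  set D := seqPoly N (padeSnd z (e s) 1 0)
  have hw : ∀ j, (z j)⁻¹ * z j = 1 := fun j => inv_mul_cancel₀ (hz j)
  obtain ⟨h1, -⟩ := eq_zero_of_forall_eval_eq_zero hdet hz 2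
    (p := X * (C κ * C' + X * (C μ * C' + C ν * A - P)) + C (2 * Complex.I) * A)
    (q := X * (C κ * D + X * (C μ * D + C ν * B - Q)))
    (fun k hk => by
      interval_cases k <;>
      simp only [coeff_sub, coeff_add, coeff_X_mul, coeff_C_mul, coeff_X_mul_zero, cA, cC, hP0,
        padeFst_zero, ← ha, ← hα₂, ← hγ₁]
      · ring
      · rw [hκ]; ring
      · rw [hμ]; ring)
    (fun k hk => by
      obtain ⟨k, rfl⟩ : ∃ l, k = l + 2 := ⟨k - 2, by omega⟩
      simp only [coeff_sub, coeff_add, coeff_X_mul, coeff_C_mul, cA, cC, hPN k (by omega),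
        zC k (by omega), zC (k + 1) (by omega), zA k (by omega), zA (k + 2) (by omega)]
      ring)
    (fun k hk => by
      interval_cases k <;>
      simp only [coeff_sub, coeff_add, coeff_X_mul, coeff_C_mul, coeff_X_mul_zero, cB, cD, hQ0,
        padeSnd_zero, ← hd]
      · ring
      · rw [hν]; ring)
    (fun k hk => by
      obtain ⟨k, rfl⟩ : ∃ l, k = l + 2 := ⟨k - 2, by omega⟩
      simp only [coeff_sub, coeff_add, coeff_X_mul, coeff_C_mul, cB, cD, hQN k (by omega),
        zD k (by omega), zD (k + 1) (by omega), zB k (by omega)]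
      ring)
    (fun j => by
      simp only [eval_sub, eval_mul, eval_add, eval_X, eval_C]
      linear_combination (-(z j)⁻¹ ^ 2) * hE j + (2 * Complex.I + ν * (z j)⁻¹ ^ 2) * hAB j
        + (κ * (z j)⁻¹ + μ * (z j)⁻¹ ^ 2) * hCD j
        + 2 * Complex.I * e s j * B.eval (z j)⁻¹ * ((z j)⁻¹ * z j + 1) * hw j)
  have g1 := congrArg (fun p => p.coeff 3) h1
  simp only [coeff_sub, coeff_add, coeff_X_mul, coeff_C_mul, coeff_zero, cA, cC, ← ha, ← hα₃,
    ← hγ₁, ← hγ₂] at g1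
  exact (hP 1).congr_deriv (by linear_combination -g1)

/-- The cubic flow `e_j' = -2 z_j³ e_j`, read off at the first coefficient. The scalars `κ`, …, `σ`
are chosen so that the coefficients of index `≤ 3` cancel in the pair
`-2 (A, 0) + (κ w + μ w² + ρ w³) (C, D) + (ν w² + σ w³) (A, B) - w³ (A, B)_t`. It then vanishes by
uniqueness, and its coefficient of index `4` is the claim. -/
theorem hasDerivAt_pade_mkdv {N : ℕ} {z : Fin (N + N) → ℂ} {e : ℝ → Fin (N + N) → ℂ} {s : ℝ}
    (hz : ∀ j, z j ≠ 0)
    (he : ∀ j, HasDerivAt (fun s => e s j) (-2 * z j ^ 3 * e s j) s)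
    (hdet : (pairedVandermonde N z (e s)).det ≠ 0)
    {a α₂ α₃ α₄ β₁ γ₁ γ₂ γ₃ d δ₂ κ μ ν ρ σ : ℂ}
    (ha : a = padeFst z (e s) 0 1 1) (hα₂ : α₂ = padeFst z (e s) 0 1 2)
    (hα₃ : α₃ = padeFst z (e s) 0 1 3) (hα₄ : α₄ = padeFst z (e s) 0 1 4)
    (hβ₁ : β₁ = padeSnd z (e s) 0 1 1) (hγ₁ : γ₁ = padeFst z (e s) 1 0 1)
    (hγ₂ : γ₂ = padeFst z (e s) 1 0 2) (hγ₃ : γ₃ = padeFst z (e s) 1 0 3)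
    (hd : d = padeSnd z (e s) 1 0 1) (hδ₂ : δ₂ = padeSnd z (e s) 1 0 2)
    (hκ : κ = 2 * a) (hμ : μ = 2 * α₂ - κ * γ₁) (hν : ν = -κ * d)
    (hρ : ρ = 2 * α₃ - κ * γ₂ - μ * γ₁ - ν * a) (hσ : σ = -κ * δ₂ - μ * d - ν * β₁) :
    HasDerivAt (fun s => padeFst z (e s) 0 1 1)
      (-2 * α₄ + κ * γ₃ + μ * γ₂ + ν * α₂ + ρ * γ₁ + σ * a) s := by
  obtain ⟨P, Q, hP, hQ, ⟨hP0, hPN⟩, ⟨hQ0, hQN⟩, hE⟩ := exists_deriv_pade hz he hdet 0 1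
  have cA := coeff_padeFst z (e s) 0 1
  have cB := coeff_padeSnd z (e s) 0 1
  have cC := coeff_padeFst z (e s) 1 0
  have cD := coeff_padeSnd z (e s) 1 0
  have hAB := eval_pade_eq_zero hdet hz 0 1
  have hCD := eval_pade_eq_zero hdet hz 1 0
  have zA := fun k hk => padeFst_of_lt z (e s) 0 1 (k := k) hk
  have zB := fun k hk => padeSnd_of_lt z (e s) 0 1 (k := k) hk
  have zC := fun k hk => padeFst_of_lt z (e s) 1 0 (k := k) hk
  have zD := fun k hk => padeSnd_of_lt z (e s) 1 0 (k := k) hk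
  set A := seqPoly N (padeFst z (e s) 0 1)
  set B := seqPoly N (padeSnd z (e s) 0 1)
  set C' := seqPoly N (padeFst z (e s) 1 0)
  set D := seqPoly N (padeSnd z (e s) 1 0)
  have hw : ∀ j, (z j)⁻¹ * z j = 1 := fun j => inv_mul_cancel₀ (hz j)
  obtain ⟨h1, -⟩ := eq_zero_of_forall_eval_eq_zero hdet hz 3
    (p := X * (C κ * C' + X * (C μ * C' + C ν * A + X * (C ρ * C' + C σ * A - P))) - C 2 * A)
    (q := X * (C κ * D + X * (C μ * D + C ν * B + X * (C ρ * D + C σ * B - Q))))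
    (fun k hk => by
      interval_cases k <;>
      simp only [coeff_sub, coeff_add, coeff_X_mul, coeff_C_mul, coeff_X_mul_zero, cA, cC, hP0,
        padeFst_zero, ← ha, ← hα₂, ← hα₃, ← hγ₁, ← hγ₂]
      · ring
      · rw [hκ]; ring
      · rw [hμ]; ring
      · rw [hρ]; ring)
    (fun k hk => by
      obtain ⟨k, rfl⟩ : ∃ l, k = l + 3 := ⟨k - 3, by omega⟩
      simp only [coeff_sub, coeff_add, coeff_X_mul, coeff_C_mul, cA, cC, hPN k (by omega),
        zC k (by omega), zC (k + 1) (by omega), zC (k + 2) (by omega), zA k (by omega),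
        zA (k + 1) (by omega), zA (k + 3) (by omega)]
      ring)
    (fun k hk => by
      interval_cases k <;>
      simp only [coeff_sub, coeff_add, coeff_X_mul, coeff_C_mul, coeff_X_mul_zero, cB, cD, hQ0,
        padeSnd_zero, ← hd, ← hδ₂, ← hβ₁]
      · ring
      · rw [hν]; ring
      · rw [hσ]; ring)
    (fun k hk => by
      obtain ⟨k, rfl⟩ : ∃ l, k = l + 3 := ⟨k - 3, by omega⟩
      simp only [coeff_sub, coeff_add, coeff_X_mul, coeff_C_mul, cB, cD, hQN k (by omega),
        zD k (by omega), zD (k + 1) (by omega), zD (k + 2) (by omega), zB k (by omega),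
        zB (k + 1) (by omega)]
      ring)
    (fun j => by
      simp only [eval_sub, eval_mul, eval_add, eval_X, eval_C]
      linear_combination (-(z j)⁻¹ ^ 3) * hE j
        + (-2 + ν * (z j)⁻¹ ^ 2 + σ * (z j)⁻¹ ^ 3) * hAB j
        + (κ * (z j)⁻¹ + μ * (z j)⁻¹ ^ 2 + ρ * (z j)⁻¹ ^ 3) * hCD j
        - 2 * e s j * B.eval (z j)⁻¹ * (((z j)⁻¹ * z j) ^ 2 + (z j)⁻¹ * z j + 1) * hw j)
  have g1 := congrArg (fun p => p.coeff 4) h1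
  simp only [coeff_sub, coeff_add, coeff_X_mul, coeff_C_mul, coeff_zero, cA, cC, ← ha, ← hα₂,
    ← hα₄, ← hγ₁, ← hγ₂, ← hγ₃] at g1
  exact (hP 1).congr_deriv (by linear_combination -g1)

/-! ### Elimination of the auxiliary coefficients -/

theorem iteratedDeriv_two_eq_of_eventually {f f₁ : ℝ → ℂ} {c : ℂ} {x : ℝ}
    (h₁ : ∀ᶠ y in nhds x, HasDerivAt f (f₁ y) y) (h₂ : HasDerivAt f₁ c x) :
    iteratedDeriv 2 f x = c := by
  have e₁ : deriv f =ᶠ[nhds x] f₁ := h₁.mono fun y hy => hy.deriv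
  rw [iteratedDeriv_succ, iteratedDeriv_one, e₁.deriv_eq, h₂.deriv]

theorem iteratedDeriv_three_eq_of_eventually {f f₁ f₂ : ℝ → ℂ} {c : ℂ} {x : ℝ}
    (h₁ : ∀ᶠ y in nhds x, HasDerivAt f (f₁ y) y) (h₂ : ∀ᶠ y in nhds x, HasDerivAt f₁ (f₂ y) y)
    (h₃ : HasDerivAt f₂ c x) : iteratedDeriv 3 f x = c := by
  have e₂ : iteratedDeriv 2 f =ᶠ[nhds x] f₂ := by
    filter_upwards [h₁.eventually_nhds, h₂] with y hy hy'
    exact iteratedDeriv_two_eq_of_eventually hy hy'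
  rw [iteratedDeriv_succ, e₂.deriv_eq, h₃.deriv]

theorem eventually_det_pairedVandermonde_ne_zero {N : ℕ} {z : Fin (N + N) → ℂ}
    {e : ℝ → Fin (N + N) → ℂ} {x : ℝ} (he : ∀ j, DifferentiableAt ℝ (fun x => e x j) x)
    (hdet : (pairedVandermonde N z (e x)).det ≠ 0) :
    ∀ᶠ y in nhds x, (pairedVandermonde N z (e y)).det ≠ 0 :=
  (DifferentiableAt.matrix_det
    (differentiableAt_pairedVandermonde he)).continuousAt.eventually_ne hdet

/-- The first three `x`-derivatives of `a = α₁` as polynomials in the coefficients of the two pairs,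
by repeated use of the `x`-flow. -/
theorem hasDerivAt_padeFst_one {N : ℕ} {z : Fin (N + N) → ℂ} {e : ℝ → Fin (N + N) → ℂ} {x : ℝ}
    (hz : ∀ j, z j ≠ 0) (he : ∀ j x, HasDerivAt (fun x => e x j) (2 * z j * e x j) x)
    (hdet : (pairedVandermonde N z (e x)).det ≠ 0) {a α₂ α₃ α₄ β₁ γ₁ γ₂ γ₃ d δ₂ a₁ a₂ : ℝ → ℂ}
    (ha : a = fun x => padeFst z (e x) 0 1 1) (hα₂ : α₂ = fun x => padeFst z (e x) 0 1 2)
    (hα₃ : α₃ = fun x => padeFst z (e x) 0 1 3) (hα₄ : α₄ = fun x => padeFst z (e x) 0 1 4)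
    (hβ₁ : β₁ = fun x => padeSnd z (e x) 0 1 1) (hγ₁ : γ₁ = fun x => padeFst z (e x) 1 0 1)
    (hγ₂ : γ₂ = fun x => padeFst z (e x) 1 0 2) (hγ₃ : γ₃ = fun x => padeFst z (e x) 1 0 3)
    (hd : d = fun x => padeSnd z (e x) 1 0 1) (hδ₂ : δ₂ = fun x => padeSnd z (e x) 1 0 2)
    (ha₁ : a₁ = fun x => 2 * α₂ x - 2 * (a x * γ₁ x))
    (ha₂ : a₂ = fun x => 4 * (α₃ x - a x * γ₂ x) - 2 * (a₁ x * γ₁ x) - 4 * (a x ^ 2 * d x)) :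
    HasDerivAt a (a₁ x) x ∧ HasDerivAt a₁ (a₂ x) x ∧
      HasDerivAt a₂
        (4 * (2 * α₄ x - 2 * a x * γ₃ x - a₁ x * γ₂ x - a x * (2 * d x * α₂ x))
          - 2 * (a₂ x * γ₁ x + a₁ x * (2 * d x * a x))
          - 4 * (2 * a x * a₁ x * d x + a x ^ 2 * (-2 * δ₂ x + 2 * d x * β₁ x))) x := by
  have h := fun k => hasDerivAt_pade hz (fun j => he j x) hdet k
  have da : HasDerivAt a (a₁ x) x := by
    rw [ha]
    refine (h 1).1.congr_deriv ?_
    rw [ha₁, hα₂, ha, hγ₁]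
    ring
  have dα₂ : HasDerivAt α₂ (2 * α₃ x - 2 * a x * γ₂ x) x := by
    rw [hα₂, hα₃, ha, hγ₂]; exact (h 2).1
  have dα₃ : HasDerivAt α₃ (2 * α₄ x - 2 * a x * γ₃ x) x := by
    rw [hα₃, hα₄, ha, hγ₃]; exact (h 3).1
  have dγ₁ : HasDerivAt γ₁ (2 * d x * a x) x := by
    rw [hγ₁, hd, ha]; exact (h 1).2.2.1
  have dγ₂ : HasDerivAt γ₂ (2 * d x * α₂ x) x := by
    rw [hγ₂, hd, hα₂]; exact (h 2).2.2.1
  have dd : HasDerivAt d (-2 * δ₂ x + 2 * d x * β₁ x) x := by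
    rw [hd, hδ₂, hβ₁]; exact (h 1).2.2.2
  have da₁ : HasDerivAt a₁ (a₂ x) x := by
    have := (dα₂.const_mul 2).fun_sub ((da.fun_mul dγ₁).const_mul 2)
    rw [← ha₁] at this
    refine this.congr_deriv ?_
    simp only [ha₂]
    ring
  refine ⟨da, da₁, ?_⟩
  have := (((dα₃.fun_sub (da.fun_mul dγ₂)).const_mul 4).fun_sub
    ((da₁.fun_mul dγ₁).const_mul 2)).fun_sub (((da.fun_pow 2).fun_mul dd).const_mul 4)
  rw [← ha₂] at this
  refine this.congr_deriv ?_
  simp only [Nat.add_one_sub_one, Nat.cast_ofNat, pow_one]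
  ring

/-- The two AKNS potentials `a`, `d` satisfy `a_t = (i / 2) (a_xx + 8 a² d)` under the quadratic
flow. -/
theorem deriv_padeFst_nse {N : ℕ} {z : Fin (N + N) → ℂ} {e : ℝ → ℝ → Fin (N + N) → ℂ} {x t : ℝ}
    (hz : ∀ j, z j ≠ 0) (hx : ∀ j x t, HasDerivAt (fun x => e x t j) (2 * z j * e x t j) x)
    (ht : ∀ j x t, HasDerivAt (fun t => e x t j) (2 * Complex.I * z j ^ 2 * e x t j) t)
    (hdet : (pairedVandermonde N z (e x t)).det ≠ 0) :
    deriv (fun t => padeFst z (e x t) 0 1 1) t =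
      Complex.I / 2 * (iteratedDeriv 2 (fun x => padeFst z (e x t) 0 1 1) x +
        8 * padeFst z (e x t) 0 1 1 ^ 2 * padeSnd z (e x t) 1 0 1) := by
  have hev := eventually_det_pairedVandermonde_ne_zero (e := fun x => e x t)
    (fun j => (hx j x t).differentiableAt) hdet
  have h := fun {y} (hy : (pairedVandermonde N z (e y t)).det ≠ 0) =>
    hasDerivAt_padeFst_one (e := fun x => e x t) hz (fun j x => hx j x t) hy
      rfl rfl rfl rfl rfl rfl rfl rfl rfl rfl rfl rfl
  rw [iteratedDeriv_two_eq_of_eventually (hev.mono fun y hy => (h hy).1) (h hdet).2.1,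
    (hasDerivAt_pade_nse (e := fun t => e x t) hz (fun j => ht j x t) hdet
      rfl rfl rfl rfl rfl rfl rfl rfl rfl).deriv]
  ring

/-- The two AKNS potentials `a`, `d` satisfy `a_t = - a_xxx / 4 - 6 a d a_x` under the cubic
flow. -/
theorem deriv_padeFst_mkdv {N : ℕ} {z : Fin (N + N) → ℂ} {e : ℝ → ℝ → Fin (N + N) → ℂ} {x t : ℝ}
    (hz : ∀ j, z j ≠ 0) (hx : ∀ j x t, HasDerivAt (fun x => e x t j) (2 * z j * e x t j) x)
    (ht : ∀ j x t, HasDerivAt (fun t => e x t j) (-2 * z j ^ 3 * e x t j) t)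
    (hdet : (pairedVandermonde N z (e x t)).det ≠ 0) :
    deriv (fun t => padeFst z (e x t) 0 1 1) t =
      -(1 / 4) * iteratedDeriv 3 (fun x => padeFst z (e x t) 0 1 1) x -
        6 * padeFst z (e x t) 0 1 1 * padeSnd z (e x t) 1 0 1 *
          deriv (fun x => padeFst z (e x t) 0 1 1) x := by
  have hev := eventually_det_pairedVandermonde_ne_zero (e := fun x => e x t)
    (fun j => (hx j x t).differentiableAt) hdet
  have h := fun {y} (hy : (pairedVandermonde N z (e y t)).det ≠ 0) =>
    hasDerivAt_padeFst_one (e := fun x => e x t) hz (fun j x => hx j x t) hy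
      rfl rfl rfl rfl rfl rfl rfl rfl rfl rfl rfl rfl
  rw [iteratedDeriv_three_eq_of_eventually (hev.mono fun y hy => (h hy).1)
    (hev.mono fun y hy => (h hy).2.1) (h hdet).2.2, (h hdet).1.deriv,
    (hasDerivAt_pade_mkdv (e := fun t => e x t) hz (fun j => ht j x t) hdet
      rfl rfl rfl rfl rfl rfl rfl rfl rfl rfl rfl rfl rfl rfl rfl).deriv]
  ring

/-! ### Density of the set where the determinant does not vanish -/

/-- The homogeneous form of `pairedVandermonde`, with weights on both blocks of `N` rows. -/
def weightedVandermonde {N : ℕ} (z u w : Fin (N + N) → ℂ) :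
    Matrix (Fin (N + N)) (Fin (N + N)) ℂ :=
  fun i j => if (i : ℕ) < N then z j ^ (i : ℕ) * u j else z j ^ ((i : ℕ) - N) * w j

theorem weightedVandermonde_mul {N : ℕ} (z e c : Fin (N + N) → ℂ) :
    weightedVandermonde z c (e * c) = pairedVandermonde N z e * diagonal c := by
  ext i j
  rw [mul_diagonal, weightedVandermonde, pairedVandermonde]
  split_ifs
  · rfl
  · simp [mul_assoc]

/-- With these weights the matrix consists of two Vandermonde blocks and two zero blocks. -/
theorem det_weightedVandermonde_ne_zero {N : ℕ} {z : Fin (N + N) → ℂ}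
    (hz : Function.Injective z) :
    (weightedVandermonde z (Fin.append 0 1) (Fin.append 1 0)).det ≠ 0 := by
  intro h
  obtain ⟨v, hv, hv0⟩ := exists_vecMul_eq_zero_iff.2 h
  have key : ∀ j : Fin (N + N),
      (∑ i : Fin N, v (Fin.castAdd N i) * z j ^ (i : ℕ)) *
          (Fin.append 0 1 : Fin (N + N) → ℂ) j +
        (∑ i : Fin N, v (Fin.natAdd N i) * z j ^ (i : ℕ)) *
          (Fin.append 1 0 : Fin (N + N) → ℂ) j = 0 := by
    intro j
    have := congrFun hv0 j
    simp only [vecMul, dotProduct, Fin.sum_univ_add, weightedVandermonde, Pi.zero_apply,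
      Fin.val_castAdd, Fin.val_natAdd, Fin.is_lt, if_true, add_lt_iff_neg_left, not_lt_zero,
      if_false, add_tsub_cancel_left, ← mul_assoc, ← Finset.sum_mul] at this
    exact this
  have h1 : (fun i : Fin N => v (Fin.natAdd N i)) = 0 :=
    eq_zero_of_forall_index_sum_mul_pow_eq_zero
      (f := fun j : Fin N => z (Fin.castAdd N j)) (hz.comp (Fin.castAdd_injective N N)) fun j => by
        simpa only [Fin.append_left, Pi.zero_apply, Pi.one_apply, mul_zero, zero_add, mul_one]
          using key (Fin.castAdd N j)
  have h2 : (fun i : Fin N => v (Fin.castAdd N i)) = 0 :=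
    eq_zero_of_forall_index_sum_mul_pow_eq_zero
      (f := fun j : Fin N => z (Fin.natAdd N j)) (hz.comp (Fin.natAdd_injective N N)) fun j => by
        simpa only [Fin.append_right, Pi.zero_apply, Pi.one_apply, mul_zero, add_zero, mul_one]
          using key (Fin.natAdd N j)
  refine hv (funext fun i => ?_)
  refine Fin.addCases (fun i => ?_) (fun i => ?_) i
  · exact congrFun h2 i
  · exact congrFun h1 i

theorem tendsto_cexp_zero {z : ℂ} (hz : z.re < 0) (b : ℂ) :
    Filter.Tendsto (fun x : ℝ => Complex.exp (2 * z * x + b)) Filter.atTop (nhds 0) := by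
  refine Complex.tendsto_exp_comap_re_atBot.comp (Filter.tendsto_comap_iff.2 ?_)
  have : (Complex.re ∘ fun x : ℝ => 2 * z * x + b) = fun x : ℝ => (2 * z.re) * x + b.re := by
    funext x; simp
  rw [this]
  exact Filter.tendsto_atBot_add_const_right _ _
    (Filter.tendsto_id.const_mul_atTop_of_neg (by linarith))

theorem exists_det_pairedVandermonde_ne_zero {N : ℕ} {z : Fin (N + N) → ℂ}
    (hz : Function.Injective z) (hl : ∀ k, 0 < (z (Fin.castAdd N k)).re)
    (hr : ∀ k, (z (Fin.natAdd N k)).re < 0) (b : Fin (N + N) → ℂ) :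
    ∃ x : ℝ, (pairedVandermonde N z fun j => Complex.exp (2 * z j * x + b j)).det ≠ 0 := by
  by_contra! h
  set e : ℝ → Fin (N + N) → ℂ := fun x j => Complex.exp (2 * z j * x + b j) with he
  -- the growing columns are divided by their weights
  set c : ℝ → Fin (N + N) → ℂ := fun x =>
    Fin.append (fun k => (e x (Fin.castAdd N k))⁻¹) 1 with hc
  have h0 : ∀ x, (weightedVandermonde z (c x) (e x * c x)).det = 0 := fun x => by
    rw [weightedVandermonde_mul, det_mul, h x, zero_mul]
  have hce : ∀ x, e x * c x = Fin.append 1 fun k => e x (Fin.natAdd N k) := by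
    intro x
    funext j
    refine Fin.addCases (fun k => ?_) (fun k => ?_) j
    · simp only [hc, Pi.mul_apply, Fin.append_left, Pi.one_apply]
      exact mul_inv_cancel₀ (Complex.exp_ne_zero _)
    · simp only [hc, Pi.mul_apply, Fin.append_right, Pi.one_apply, mul_one]
  have t1 : ∀ j, Filter.Tendsto (fun x => c x j) Filter.atTop
      (nhds ((Fin.append 0 1 : Fin (N + N) → ℂ) j)) := by
    refine Fin.addCases (fun k => ?_) (fun k => ?_)
    · simp only [hc, Fin.append_left, Pi.zero_apply, he, ← Complex.exp_neg]
      have := tendsto_cexp_zero (z := -z (Fin.castAdd N k)) (by simpa using hl k)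
        (-b (Fin.castAdd N k))
      refine this.congr fun x => ?_
      congr 1; ring
    · simp only [hc, Fin.append_right, Pi.one_apply]
      exact tendsto_const_nhds
  have t2 : ∀ j, Filter.Tendsto (fun x => (e x * c x) j) Filter.atTop
      (nhds ((Fin.append 1 0 : Fin (N + N) → ℂ) j)) := by
    simp only [hce]
    refine Fin.addCases (fun k => ?_) (fun k => ?_)
    · simp only [Fin.append_left, Pi.one_apply]
      exact tendsto_const_nhds
    · simp only [Fin.append_right, Pi.zero_apply]
      exact tendsto_cexp_zero (hr k) _
  have t3 : Filter.Tendsto (fun x => weightedVandermonde z (c x) (e x * c x)) Filter.atTop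
      (nhds (weightedVandermonde z (Fin.append 0 1) (Fin.append 1 0))) := by
    refine tendsto_pi_nhds.2 fun i => tendsto_pi_nhds.2 fun j => ?_
    unfold weightedVandermonde
    split_ifs
    · exact (t1 j).const_mul _
    · exact (t2 j).const_mul _
  have t4 := ((continuous_id.matrix_det (n := Fin (N + N)) (R := ℂ)).tendsto _).comp t3
  refine det_weightedVandermonde_ne_zero hz (tendsto_nhds_unique t4 ?_)
  exact tendsto_const_nhds.congr fun x => (h0 x).symm

theorem contDiff_det_pairedVandermonde {n m : ℕ} {E : Type*} [NormedAddCommGroup E]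
    [NormedSpace ℝ E] {k : WithTop ℕ∞} (z : Fin n → ℂ) {e : E → Fin n → ℂ}
    (he : ∀ j, ContDiff ℝ k fun p => e p j) :
    ContDiff ℝ k fun p => (pairedVandermonde m z (e p)).det := by
  refine ContDiff.matrix_det fun i j => ?_
  unfold pairedVandermonde
  split_ifs
  · exact contDiff_const
  · exact contDiff_const.mul (he j)

theorem dense_det_pairedVandermonde_ne_zero {N : ℕ} {z : Fin (N + N) → ℂ}
    (hz : Function.Injective z) (hl : ∀ k, 0 < (z (Fin.castAdd N k)).re)
    (hr : ∀ k, (z (Fin.natAdd N k)).re < 0) (b : ℝ → Fin (N + N) → ℂ) :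
    Dense {p : ℝ × ℝ |
      (pairedVandermonde N z fun j => Complex.exp (2 * z j * p.1 + b p.2 j)).det ≠ 0} := by
  rintro ⟨x₀, t⟩
  set f : ℝ → ℂ := fun x => (pairedVandermonde N z fun j => Complex.exp (2 * z j * x + b t j)).det
    with hf
  have hfan : AnalyticOnNhd ℝ f Set.univ := by
    rw [← contDiff_omega_iff_analyticOnNhd]
    refine contDiff_det_pairedVandermonde z fun j => ContDiff.cexp ?_
    exact (contDiff_const.mul Complex.ofRealCLM.contDiff).add contDiff_const
  have hev : ∀ᶠ x in nhdsWithin x₀ {x₀}ᶜ, f x ≠ 0 := by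
    by_contra hne
    have hfr : ∃ᶠ x in nhdsWithin x₀ {x₀}ᶜ, f x = (fun _ => (0 : ℂ)) x := by
      exact hne
    have := hfan.eq_of_frequently_eq (analyticOnNhd_const (v := (0 : ℂ))) hfr
    obtain ⟨x, hx⟩ := exists_det_pairedVandermonde_ne_zero hz hl hr (b t)
    exact hx (congrFun this x)
  rw [mem_closure_iff_frequently]
  have hcont : Filter.Tendsto (fun x : ℝ => (x, t)) (nhdsWithin x₀ {x₀}ᶜ) (nhds (x₀, t)) :=
    ((continuous_id.prodMk continuous_const).tendsto x₀).mono_left nhdsWithin_le_nhds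
  exact hcont.frequently (p := fun p : ℝ × ℝ => _) hev.frequently

/-! ### The quotient of determinants as an interpolation coefficient -/

/-- `Δ₁` is the numerator of Cramer's formula after the unweighted row `N - 1`, replaced by
`z_j^N e_j`, has been moved past the `N` rows below it. Where `Δ₂ = 0` both sides are zero. -/
theorem xiRatio_eq_padeFst {N : ℕ} (hN : 1 ≤ N) (ω ψ ω' ψ' : Fin N → ℂ) :
    xiRatio ω ψ ω' ψ' =
      2 * padeFst (Fin.append ω (-ω')) (Fin.append ψ ψ'⁻¹) 0 1 1 := by
  set z := Fin.append ω (-ω')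
  set e := Fin.append ψ ψ'⁻¹
  set i₀ : Fin (N + N) := ⟨N - 1, by omega⟩ with hi₀
  set i₁ : Fin (N + N) := ⟨N + N - 1, by omega⟩ with hi₁
  have hle : i₀ ≤ i₁ := Fin.le_def.2 (by simp only [hi₀, hi₁]; omega)
  have : NeZero (N + N) := ⟨by omega⟩
  set U := (pairedVandermonde N z e).updateRow i₀ fun j => z j ^ N * (0 + 1 * e j) with hU
  have h1 : pairedVandermonde (N - 1) z e = U.submatrix (Fin.cycleIcc i₀ i₁) id := by
    ext i j
    rw [submatrix_apply, id, hU, updateRow_apply]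
    rcases lt_or_ge i i₀ with h | h
    · rw [Fin.cycleIcc_of_lt h, if_neg h.ne, pairedVandermonde, pairedVandermonde]
      have : (i : ℕ) < N - 1 := h
      rw [if_pos this, if_pos (by omega)]
    · have h' : N - 1 ≤ (i : ℕ) := h
      rcases lt_or_eq_of_le (show i ≤ i₁ from Fin.le_def.2 (by simp [hi₁]; omega)) with h2 | h2
      · have h2' : (i : ℕ) < N + N - 1 := h2
        have hval : ((i + 1 : Fin (N + N)) : ℕ) = i + 1 := by
          rw [Fin.val_add_one_of_lt' (by omega)]
        rw [Fin.cycleIcc_of_ge_of_lt h h2, if_neg (fun hh => by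
          have := congrArg Fin.val hh
          rw [hval] at this
          simp only [hi₀] at this
          omega), pairedVandermonde, pairedVandermonde, hval, if_neg (by omega),
          if_neg (by omega)]
        congr 2
        omega
      · rw [h2, Fin.cycleIcc_of_last hle, if_pos rfl, pairedVandermonde, if_neg (by
          simp only [hi₁]; omega)]
        rw [zero_add, one_mul]
        congr 2
        simp only [hi₁]
        omega
  have h2 : Delta1 ω ψ ω' ψ' = (-1) ^ N * U.det := by
    rw [Delta1, h1, det_permute, Fin.sign_cycleIcc_of_le hle]
    have : (i₁ : ℕ) - i₀ = N := by simp only [hi₁, hi₀]; omega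
    rw [this]
    push_cast
    rfl
  have h3 : padeFst z e 0 1 1 = -(U.det / (pairedVandermonde N z e).det) := by
    rw [padeFst, revSeq, if_neg one_ne_zero, dif_pos (by omega), padeVec]
    have : Fin.castAdd N (Fin.rev (⟨1 - 1, by omega⟩ : Fin N)) = i₀ := by
      ext; simp [Fin.val_rev, hi₀]
    rw [this]
  rw [xiRatio, h2, h3, Delta2]
  obtain ⟨n, rfl⟩ : ∃ n, N = n + 1 := ⟨N - 1, by omega⟩
  have : ((-1 : ℂ) ^ n) * (-1) ^ n = 1 := by rw [← mul_pow]; simp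
  rw [add_tsub_cancel_right, pow_succ, mul_div_assoc]
  linear_combination (-2 * (U.det / (pairedVandermonde (n + 1) z e).det)) * this

/-! ### Permutation of the last `N` columns -/

theorem pairedVandermonde_append_comp_perm {N : ℕ} (m : ℕ) (ω ψ ω' ψ' : Fin N → ℂ)
    (σ : Equiv.Perm (Fin N)) :
    (pairedVandermonde m (Fin.append ω (-(ω' ∘ σ))) (Fin.append ψ (ψ' ∘ σ)⁻¹)).det =
      Equiv.Perm.sign (finSumFinEquiv.permCongr
        (Equiv.Perm.sumCongr (1 : Equiv.Perm (Fin N)) σ) : Equiv.Perm (Fin (N + N))) *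
        (pairedVandermonde m (Fin.append ω (-ω')) (Fin.append ψ ψ'⁻¹)).det := by
  set τ : Equiv.Perm (Fin (N + N)) :=
    finSumFinEquiv.permCongr (Equiv.Perm.sumCongr (1 : Equiv.Perm (Fin N)) σ) with hτ
  have hτl : ∀ k, τ (Fin.castAdd N k) = Fin.castAdd N k := fun k => by
    simp [hτ, Equiv.permCongr_apply]
  have hτr : ∀ k, τ (Fin.natAdd N k) = Fin.natAdd N (σ k) := fun k => by
    rw [hτ, Equiv.permCongr_apply, finSumFinEquiv_symm_apply_natAdd]
    rfl
  have happ : ∀ a b : Fin N → ℂ, Fin.append a (b ∘ σ) = Fin.append a b ∘ τ := by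
    intro a b
    funext j
    refine Fin.addCases (fun k => ?_) (fun k => ?_) j
    · rw [Function.comp_apply, hτl, Fin.append_left, Fin.append_left]
    · rw [Function.comp_apply, hτr, Fin.append_right, Fin.append_right]; rfl
  rw [← det_permute']
  congr 1
  have e1 := happ ω (-ω')
  have e2 := happ ψ ψ'⁻¹
  ext i j
  have e1' := congrFun e1 j
  have e2' := congrFun e2 j
  simp only [submatrix_apply, id, pairedVandermonde]
  rw [show -(ω' ∘ σ) = (-ω') ∘ σ from rfl, show (ψ' ∘ σ)⁻¹ = ψ'⁻¹ ∘ σ from rfl, e1', e2']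
  rfl

theorem Delta2_comp_perm_ne_zero {N : ℕ} (ω ψ ω' ψ' : Fin N → ℂ) (σ : Equiv.Perm (Fin N)) :
    Delta2 ω ψ (ω' ∘ σ) (ψ' ∘ σ) ≠ 0 ↔ Delta2 ω ψ ω' ψ' ≠ 0 := by
  rw [Delta2, Delta2, pairedVandermonde_append_comp_perm]
  simp

theorem xiRatio_comp_perm {N : ℕ} (ω ψ ω' ψ' : Fin N → ℂ) (σ : Equiv.Perm (Fin N)) :
    xiRatio ω ψ (ω' ∘ σ) (ψ' ∘ σ) = xiRatio ω ψ ω' ψ' := by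
  simp only [xiRatio, Delta1, Delta2]
  rw [pairedVandermonde_append_comp_perm, pairedVandermonde_append_comp_perm,
    mul_div_mul_left _ _ (by simp)]

/-! ### Exponential weights and reflected nodes -/

/-- Exponential weights with spatial rate `2 z_j` and temporal rate `2 g_j`. -/
noncomputable def expWeight {n : ℕ} (z g c : Fin n → ℂ) (x t : ℝ) (j : Fin n) : ℂ :=
  Complex.exp (2 * (z j * x + g j * t - c j))

theorem hasDerivAt_expWeight_fst {n : ℕ} (z g c : Fin n → ℂ) (j : Fin n) (x t : ℝ) :
    HasDerivAt (fun x => expWeight z g c x t j) (2 * z j * expWeight z g c x t j) x := by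
  have h := (((((Complex.ofRealCLM.hasDerivAt (x := x)).const_mul (z j)).add_const
    (g j * t)).sub_const (c j)).const_mul 2).cexp
  refine h.congr_deriv ?_
  simp only [expWeight, Complex.ofRealCLM_apply, Complex.ofReal_one]
  ring

theorem hasDerivAt_expWeight_snd {n : ℕ} (z g c : Fin n → ℂ) (j : Fin n) (x t : ℝ) :
    HasDerivAt (fun t => expWeight z g c x t j) (2 * g j * expWeight z g c x t j) t := by
  have h := (((((Complex.ofRealCLM.hasDerivAt (x := t)).const_mul (g j)).const_add
    (z j * x)).sub_const (c j)).const_mul 2).cexp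
  refine h.congr_deriv ?_
  simp only [expWeight, Complex.ofRealCLM_apply, Complex.ofReal_one]
  ring

theorem contDiff_expWeight {n : ℕ} (z g c : Fin n → ℂ) (j : Fin n) {k : WithTop ℕ∞} :
    ContDiff ℝ k fun p : ℝ × ℝ => expWeight z g c p.1 p.2 j := by
  have h1 : ContDiff ℝ k fun p : ℝ × ℝ => (p.1 : ℂ) := Complex.ofRealCLM.contDiff.comp contDiff_fst
  have h2 : ContDiff ℝ k fun p : ℝ × ℝ => (p.2 : ℂ) := Complex.ofRealCLM.contDiff.comp contDiff_snd
  exact (contDiff_const.mul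
    (((contDiff_const.mul h1).add (contDiff_const.mul h2)).sub contDiff_const)).cexp

/-- The `2 N` nodes `ω_1, …, ω_N, -ω̄_1, …, -ω̄_N`. -/
def reflectedNodes {N : ℕ} (ω : Fin N → ℂ) : Fin (N + N) → ℂ := Fin.append ω (-star ω)

theorem reflectedNodes_injective {N : ℕ} {ω : Fin N → ℂ} (hω : Function.Injective ω)
    (hre : ∀ k, 0 < (ω k).re) : Function.Injective (reflectedNodes ω) := by
  have hne : ∀ k l, ω k ≠ (-star ω) l := fun k l h => by
    have h1 := congrArg Complex.re h
    simp only [Pi.neg_apply, Pi.star_apply, Complex.neg_re, Complex.star_def, Complex.conj_re] at h1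
    linarith [hre k, hre l]
  rw [reflectedNodes, Fin.append_injective_iff]
  refine ⟨hω, fun k l h => hω (star_injective (neg_injective h)), fun k l => hne k l⟩

theorem reflectedNodes_ne_zero {N : ℕ} {ω : Fin N → ℂ} (hre : ∀ k, 0 < (ω k).re)
    (j : Fin (N + N)) : reflectedNodes ω j ≠ 0 := by
  have h0 : ∀ k, ω k ≠ 0 := fun k h => by have := hre k; simp [h] at this
  refine Fin.addCases (fun k => ?_) (fun k => ?_) j
  · rw [reflectedNodes, Fin.append_left]; exact h0 k
  · rw [reflectedNodes, Fin.append_right]; simpa using h0 k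

theorem exists_reflected {N : ℕ} (ω ψ : Fin N → ℂ) (j : Fin (N + N)) :
    ∃ i, reflectedNodes ω j = -conj (reflectedNodes ω i) ∧
      (Fin.append ψ (star ψ)⁻¹ : Fin (N + N) → ℂ) j =
        (conj ((Fin.append ψ (star ψ)⁻¹ : Fin (N + N) → ℂ) i))⁻¹ := by
  refine Fin.addCases (fun k => ⟨Fin.natAdd N k, ?_⟩) (fun k => ⟨Fin.castAdd N k, ?_⟩) j
  · rw [reflectedNodes, Fin.append_left, Fin.append_right, Fin.append_left, Fin.append_right]
    simp
  · rw [reflectedNodes, Fin.append_left, Fin.append_right, Fin.append_left, Fin.append_right]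
    simp

theorem append_psiMKdV {N : ℕ} (ω α : Fin N → ℂ) (x t : ℝ) :
    Fin.append (psiMKdV ω α x t) (star (psiMKdV ω α x t))⁻¹ =
      expWeight (reflectedNodes ω) (fun j => -reflectedNodes ω j ^ 3)
        (Fin.append (fun k => (phaseConst ω α k : ℂ)) fun k => -(phaseConst ω α k : ℂ)) x t := by
  funext j
  refine Fin.addCases (fun k => ?_) (fun k => ?_) j
  · simp only [expWeight, reflectedNodes, Fin.append_left, psiMKdV]
    ring_nf
  · simp only [expWeight, reflectedNodes, Fin.append_right, psiMKdV, Pi.inv_apply, Pi.star_apply,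
      Complex.star_def, ← Complex.exp_conj, ← Complex.exp_neg, Pi.neg_apply]
    congr 1
    simp only [map_mul, map_sub, map_pow, Complex.conj_ofReal, Complex.conj_ofNat]
    ring

theorem append_psiNSE {N : ℕ} (ω α : Fin N → ℂ) (x t : ℝ) :
    Fin.append (psiNSE ω α x t) (star (psiNSE ω α x t))⁻¹ =
      expWeight (reflectedNodes ω) (fun j => Complex.I * reflectedNodes ω j ^ 2)
        (Fin.append (fun k => (phaseConst ω α k : ℂ)) fun k => -(phaseConst ω α k : ℂ)) x t := by
  funext j
  refine Fin.addCases (fun k => ?_) (fun k => ?_) j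
  · simp only [expWeight, reflectedNodes, Fin.append_left, psiNSE]
  · simp only [expWeight, reflectedNodes, Fin.append_right, psiNSE, Pi.inv_apply, Pi.star_apply,
      Complex.star_def, ← Complex.exp_conj, ← Complex.exp_neg, Pi.neg_apply]
    congr 1
    simp only [map_mul, map_sub, map_add, map_pow, Complex.conj_ofReal, Complex.conj_ofNat,
      Complex.conj_I]
    ring

/-! ### The determinant quotient solves the equations -/

section

variable {N : ℕ} {ω : Fin N → ℂ} {ψ : ℝ → ℝ → Fin N → ℂ} {g c : Fin (N + N) → ℂ}

theorem dense_Delta2_ne_zero (hω : Function.Injective ω) (hre : ∀ k, 0 < (ω k).re)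
    (hψ : ∀ x t, Fin.append (ψ x t) (star (ψ x t))⁻¹ = expWeight (reflectedNodes ω) g c x t) :
    Dense {p : ℝ × ℝ | Delta2 ω (ψ p.1 p.2) (star ω) (star (ψ p.1 p.2)) ≠ 0} := by
  have h := dense_det_pairedVandermonde_ne_zero (reflectedNodes_injective hω hre)
    (fun k => by simpa only [reflectedNodes, Fin.append_left] using hre k)
    (fun k => by
      simpa only [reflectedNodes, Fin.append_right, Pi.neg_apply, Pi.star_apply, Complex.neg_re,
        Complex.star_def, Complex.conj_re, neg_lt_zero] using hre k)
    (fun t j => 2 * (g j * t - c j))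
  convert h using 5 with p
  rw [Delta2, hψ]
  congr 2
  funext j
  rw [expWeight]
  ring_nf

theorem isOpen_Delta2_ne_zero
    (hψ : ∀ x t, Fin.append (ψ x t) (star (ψ x t))⁻¹ = expWeight (reflectedNodes ω) g c x t) :
    IsOpen {p : ℝ × ℝ | Delta2 ω (ψ p.1 p.2) (star ω) (star (ψ p.1 p.2)) ≠ 0} := by
  simp only [Delta2, hψ]
  exact isOpen_ne_fun
    (contDiff_det_pairedVandermonde (k := 0) _ fun j => contDiff_expWeight _ g c j).continuous
    continuous_const

theorem contDiffOn_xiRatio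
    (hψ : ∀ x t, Fin.append (ψ x t) (star (ψ x t))⁻¹ = expWeight (reflectedNodes ω) g c x t)
    {k : WithTop ℕ∞} :
    ContDiffOn ℝ k
      (fun p : ℝ × ℝ => xiRatio ω (ψ p.1 p.2) (star ω) (star (ψ p.1 p.2)))
      {p : ℝ × ℝ | Delta2 ω (ψ p.1 p.2) (star ω) (star (ψ p.1 p.2)) ≠ 0} := by
  simp only [xiRatio, Delta1, Delta2, hψ]
  have h := fun m => contDiff_det_pairedVandermonde (k := k) (m := m)
    (Fin.append ω (-star ω)) fun j => contDiff_expWeight (reflectedNodes ω) g c j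
  simp only [div_eq_mul_inv]
  exact contDiffOn_const.mul ((h _).contDiffOn.mul ((h _).contDiffOn.inv fun p hp => hp))

/-- The reduction in terms of `ξ = 2 a`: `d = - ξ̄ / 2`. -/
theorem padeFst_mul_padeSnd (hre : ∀ k, 0 < (ω k).re) {x t : ℝ}
    (hψ : ∀ x t, Fin.append (ψ x t) (star (ψ x t))⁻¹ = expWeight (reflectedNodes ω) g c x t)
    (hdet : (pairedVandermonde N (reflectedNodes ω)
      (expWeight (reflectedNodes ω) g c x t)).det ≠ 0) :
    padeFst (reflectedNodes ω) (expWeight (reflectedNodes ω) g c x t) 0 1 1 *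
        padeSnd (reflectedNodes ω) (expWeight (reflectedNodes ω) g c x t) 1 0 1 =
      -(‖padeFst (reflectedNodes ω) (expWeight (reflectedNodes ω) g c x t) 0 1 1‖ : ℂ) ^ 2 := by
  rw [padeSnd_one_eq_neg_conj hdet (reflectedNodes_ne_zero hre)
    (fun j => Complex.exp_ne_zero _) (fun j => by rw [← hψ]; exact exists_reflected ω (ψ x t) j),
    mul_neg, Complex.mul_conj']

theorem isMKdVSolutionOn_xiRatio (hN : 1 ≤ N) (hre : ∀ k, 0 < (ω k).re)
    (hψ : ∀ x t, Fin.append (ψ x t) (star (ψ x t))⁻¹ =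
      expWeight (reflectedNodes ω) (fun j => -reflectedNodes ω j ^ 3) c x t) :
    IsMKdVSolutionOn {p : ℝ × ℝ | Delta2 ω (ψ p.1 p.2) (star ω) (star (ψ p.1 p.2)) ≠ 0}
      (fun x t => xiRatio ω (ψ x t) (star ω) (star (ψ x t))) := by
  refine ⟨isOpen_Delta2_ne_zero hψ, contDiffOn_xiRatio hψ, fun x t hxt => ?_⟩
  rw [Set.mem_ofPred_eq, Delta2, hψ] at hxt
  have hxi : ∀ x t, xiRatio ω (ψ x t) (star ω) (star (ψ x t)) = 2 * padeFst (reflectedNodes ω)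
      (expWeight (reflectedNodes ω) (fun j => -reflectedNodes ω j ^ 3) c x t) 0 1 1 := by
    intro x t
    rw [xiRatio_eq_padeFst hN, hψ, reflectedNodes]
  have h := deriv_padeFst_mkdv (reflectedNodes_ne_zero hre) (hasDerivAt_expWeight_fst _ _ c)
    (fun j x t => by
      simpa only [mul_neg, neg_mul] using hasDerivAt_expWeight_snd (reflectedNodes ω)
        (fun j => -reflectedNodes ω j ^ 3) c j x t) hxt
  have hd := padeFst_mul_padeSnd hre hψ hxt
  simp only [hxi, iteratedDeriv_const_mul_field, deriv_const_mul_field]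
  rw [h, norm_mul, Complex.norm_ofNat]
  push_cast
  linear_combination (-12 * deriv (fun x => padeFst (reflectedNodes ω)
    (expWeight (reflectedNodes ω) (fun j => -reflectedNodes ω j ^ 3) c x t) 0 1 1) x) * hd

theorem isNSESolutionOn_xiRatio (hN : 1 ≤ N) (hre : ∀ k, 0 < (ω k).re)
    (hψ : ∀ x t, Fin.append (ψ x t) (star (ψ x t))⁻¹ =
      expWeight (reflectedNodes ω) (fun j => Complex.I * reflectedNodes ω j ^ 2) c x t) :
    IsNSESolutionOn {p : ℝ × ℝ | Delta2 ω (ψ p.1 p.2) (star ω) (star (ψ p.1 p.2)) ≠ 0}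
      (fun x t => xiRatio ω (ψ x t) (star ω) (star (ψ x t))) := by
  refine ⟨isOpen_Delta2_ne_zero hψ, contDiffOn_xiRatio hψ, fun x t hxt => ?_⟩
  rw [Set.mem_ofPred_eq, Delta2, hψ] at hxt
  have hxi : ∀ x t, xiRatio ω (ψ x t) (star ω) (star (ψ x t)) = 2 * padeFst (reflectedNodes ω)
      (expWeight (reflectedNodes ω) (fun j => Complex.I * reflectedNodes ω j ^ 2) c x t)
        0 1 1 := by
    intro x t
    rw [xiRatio_eq_padeFst hN, hψ, reflectedNodes]
  have h := deriv_padeFst_nse (reflectedNodes_ne_zero hre) (hasDerivAt_expWeight_fst _ _ c)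
    (fun j x t => by
      exact (hasDerivAt_expWeight_snd (reflectedNodes ω)
        (fun j => Complex.I * reflectedNodes ω j ^ 2) c j x t).congr_deriv (by ring)) hxt
  have hd := padeFst_mul_padeSnd hre hψ hxt
  simp only [hxi, iteratedDeriv_const_mul_field, deriv_const_mul_field]
  rw [h, norm_mul, Complex.norm_ofNat]
  push_cast
  linear_combination (8 * Complex.I * padeFst (reflectedNodes ω) (expWeight (reflectedNodes ω)
    (fun j => Complex.I * reflectedNodes ω j ^ 2) c x t) 0 1 1) * hd

end

/-! ### Conjugation-symmetric data -/

theorem phaseConst_conj {N : ℕ} {ω α : Fin N → ℂ} {σ : Equiv.Perm (Fin N)}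
    (hσ : ∀ k, ω (σ k) = conj (ω k)) (hα : IsConjSymm α) (k : Fin N) :
    phaseConst ω α (σ k) = phaseConst ω α k := by
  obtain ⟨τ, hτ⟩ := hα
  rw [phaseConst, phaseConst, ← Equiv.prod_comp τ]
  congr 2
  refine Finset.prod_congr rfl fun i _ => ?_
  rw [hσ, hτ, ← map_sub, ← map_add, ← map_div₀, RCLike.norm_conj]

theorem psiMKdV_conj {N : ℕ} {ω α : Fin N → ℂ} {σ : Equiv.Perm (Fin N)}
    (hσ : ∀ k, ω (σ k) = conj (ω k)) (hα : IsConjSymm α) (x t : ℝ) :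
    star (psiMKdV ω α x t) = psiMKdV ω α x t ∘ σ := by
  funext k
  rw [Function.comp_apply, psiMKdV, phaseConst_conj hσ hα, hσ, Pi.star_apply, psiMKdV,
    Complex.star_def, ← Complex.exp_conj]
  simp only [map_mul, map_sub, map_pow, Complex.conj_ofReal, Complex.conj_ofNat]

theorem theorem3p3 (N : ℕ) (hN : 1 ≤ N) (ω α : Fin N → ℂ)
    (hω : Function.Injective ω) (hre : ∀ k, 0 < (ω k).re)
    (hα : ∀ k i, ω k ≠ α i ∧ ω k ≠ -α i) :
    -- modified Korteweg - de Vries equation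
    (Dense {p : ℝ × ℝ | Delta2 ω (psiMKdV ω α p.1 p.2) (star ω) (star (psiMKdV ω α p.1 p.2)) ≠ 0} ∧
      IsMKdVSolutionOn
        {p : ℝ × ℝ | Delta2 ω (psiMKdV ω α p.1 p.2) (star ω) (star (psiMKdV ω α p.1 p.2)) ≠ 0}
        (fun x t => xiRatio ω (psiMKdV ω α x t) (star ω) (star (psiMKdV ω α x t)))) ∧
    -- non-linear Schrödinger equation
    (Dense {p : ℝ × ℝ | Delta2 ω (psiNSE ω α p.1 p.2) (star ω) (star (psiNSE ω α p.1 p.2)) ≠ 0} ∧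
      IsNSESolutionOn
        {p : ℝ × ℝ | Delta2 ω (psiNSE ω α p.1 p.2) (star ω) (star (psiNSE ω α p.1 p.2)) ≠ 0}
        (fun x t => xiRatio ω (psiNSE ω α x t) (star ω) (star (psiNSE ω α x t)))) ∧
    -- for conjugation-symmetric data the conjugations can be dropped in the first case
    (IsConjSymm ω → IsConjSymm α →
      Dense {p : ℝ × ℝ | Delta2 ω (psiMKdV ω α p.1 p.2) ω (psiMKdV ω α p.1 p.2) ≠ 0} ∧
      IsMKdVSolutionOn
        {p : ℝ × ℝ | Delta2 ω (psiMKdV ω α p.1 p.2) ω (psiMKdV ω α p.1 p.2) ≠ 0}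
        (fun x t => xiRatio ω (psiMKdV ω α x t) ω (psiMKdV ω α x t))) := by

  have hM := append_psiMKdV ω α
  have hS := append_psiNSE ω α
  have mkdv := And.intro (dense_Delta2_ne_zero hω hre hM) (isMKdVSolutionOn_xiRatio hN hre hM)
  refine ⟨mkdv, ⟨dense_Delta2_ne_zero hω hre hS, isNSESolutionOn_xiRatio hN hre hS⟩, ?_⟩
  rintro ⟨σ, hσ⟩ hα'
  have hωσ : star ω = ω ∘ σ := funext fun k => (hσ k).symm
  simpa only [hωσ, psiMKdV_conj hσ hα', Delta2_comp_perm_ne_zero, xiRatio_comp_perm] using mkdv
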